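/- Consider a path $L$ with $|L|\ge 1$ hops whose legitimate nodes are at fixed positions in the plane; hop $n$ has length $|D_n|>0$ and transmit power $p_n>0$. Let $\alpha>2$ be the path loss exponent and $\lambda_e>0$. In each hop $n$, the eavesdroppers form a homogeneous Poisson point process $\Phi_{ne}$ on $\mathbb{R}^2$ with density $\lambda_e$, and $|X_{ne}|$ is the distance from the transmitter of hop $n$ to the eavesdropper $e\in\Phi_{ne}$. The fading gains $H_n$ of the legitimate channels and $S_{ne}$ of the eavesdropper channels are exponential with unit mean (Rayleigh fading). All fading gains and the point processes are independent, within each hop and across hops. Put $$\mathtt{SNR}_n=\frac{p_nH_n}{|D_n|^\alpha},\qquad \mathtt{SNR}_{ne}^{\rm sum}=\sum_{e\in\Phi_{ne}}\frac{p_nS_{ne}}{|X_{ne}|^\alpha},$$ and, for a secrecy rate $R_s\ge 0$, define the end-to-end secrecy outage probability of the path (colluding eavesdroppers, randomize-and-forward relaying, on-off transmission with threshold $2^{R_s}-1$) by $$\mathcal P_{\rm so}=\mathbb P\left(\min_n \log_2\frac{1+\mathtt{SNR}_n}{1+\mathtt{SNR}_{ne}^{\rm sum}}<R_s\ \Big|\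 \min_n \mathtt{SNR}_n>2^{R_s}-1\right).$$ Then, for all transmit powers $p_n>0$, the sums $\mathtt{SNR}_{ne}^{\rm sum}$ converge almost surely and $$\mathcal P_{\rm so}=1-\exp\left[-K_1\,2^{2R_s/\alpha}\sum_{n=1}^{|L|}|D_n|^2\right],\qquad K_1=\pi\lambda_e\,\Gamma\left(1+\tfrac2\alpha\right)\Gamma\left(1-\tfrac2\alpha\right),$$ where $\Gamma$ is the gamma function. In particular $\mathcal P_{\rm so}$ does not depend on the transmit powers. -/

import Mathlib

open MeasureTheory ProbabilityTheory

noncomputable section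

/-- The Euclidean plane, in which all nodes are located. -/
abbrev Plane : Type := EuclideanSpace ℝ (Fin 2)

/-- The number of points of the (enumerated) random point pattern `X 0 ω, X 1 ω, …` that lie
in `B`. -/
def pointCount {Ω : Type*} (X : ℕ → Ω → Plane) (B : Set Plane) (ω : Ω) : ℕ∞ :=
  {e : ℕ | X e ω ∈ B}.encard

/-- The random point pattern `X 0, X 1, …` is a homogeneous Poisson point process of density
`lam` on the plane: the number of points in a Borel set of finite area is Poisson distributed
with mean `lam` times its area, and the numbers of points in pairwise disjoint Borel sets are
independent. (For `lam > 0` such a process has infinitely many points, so that its points can be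
enumerated by `ℕ`.) -/
structure IsHomogeneousPPP {Ω : Type*} [MeasurableSpace Ω] (X : ℕ → Ω → Plane) (lam : ℝ)
    (P : Measure Ω) : Prop where
  measurable : ∀ e, Measurable (X e)
  law : ∀ B : Set Plane, MeasurableSet B → volume B ≠ ⊤ →
    HasLaw (pointCount X B)
      ((poissonMeasure (lam * volume.real B).toNNReal).map (Nat.cast : ℕ → ℕ∞)) P
  indep : ∀ (k : ℕ) (B : Fin k → Set Plane), (∀ i, MeasurableSet (B i)) →
    Pairwise (fun i j => Disjoint (B i) (B j)) →
    iIndepFun (fun i => pointCount X (B i)) P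

/-- The random environment of a path with `N` hops. For each hop `n`, `H n` is the fading gain of
the legitimate channel, `X n e` is the position of the `e`-th eavesdropper and `S n e` the fading
gain of its channel. Rayleigh fading: all gains are exponential with unit mean. The eavesdroppers
of a hop form a homogeneous Poisson point process of density `lam`. All gains, the eavesdropper
processes, and the different hops are independent. -/
structure IsRelayEnvironment {Ω : Type*} [MeasurableSpace Ω] {N : ℕ} (lam : ℝ)
    (H : Fin N → Ω → ℝ) (X : Fin N → ℕ → Ω → Plane) (S : Fin N → ℕ → Ω → ℝ)
    (P : Measure Ω) : Prop where
  measurable_H : ∀ n, Measurable (H n)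
  measurable_S : ∀ n e, Measurable (S n e)
  law_H : ∀ n, HasLaw (H n) (expMeasure 1) P
  law_S : ∀ n e, HasLaw (S n e) (expMeasure 1) P
  ppp : ∀ n, IsHomogeneousPPP (X n) lam P
  indep_hops : iIndepFun (fun n ω => (H n ω, fun e => X n e ω, fun e => S n e ω)) P
  indep_H : ∀ n, IndepFun (H n) (fun ω => (fun e => X n e ω, fun e => S n e ω)) P
  indep_X_S : ∀ n, IndepFun (fun ω e => X n e ω) (fun ω e => S n e ω) P
  indep_S : ∀ n, iIndepFun (S n) P

/-- The path visits the positions `v 0, v 1, …, v N`; hop `n` goes from `v n` to `v (n + 1)`.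
This is the length of hop `n`. -/
def hopDist {N : ℕ} (v : Fin (N + 1) → Plane) (n : Fin N) : ℝ :=
  dist (v n.castSucc) (v n.succ)

/-- The SNR at the legitimate receiver of hop `n`. -/
def legitSNR {Ω : Type*} {N : ℕ} (α : ℝ) (v : Fin (N + 1) → Plane) (p : Fin N → ℝ)
    (H : Fin N → Ω → ℝ) (n : Fin N) (ω : Ω) : ℝ :=
  p n * H n ω / hopDist v n ^ α

/-- The SNR at eavesdropper `e` of hop `n`; its distance is measured from the transmitter. -/
def eveSNR {Ω : Type*} {N : ℕ} (α : ℝ) (v : Fin (N + 1) → Plane) (p : Fin N → ℝ)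
    (X : Fin N → ℕ → Ω → Plane) (S : Fin N → ℕ → Ω → ℝ) (n : Fin N) (e : ℕ) (ω : Ω) : ℝ :=
  p n * S n e ω / dist (v n.castSucc) (X n e ω) ^ α

/-- The total SNR at the colluding eavesdroppers of hop `n`. -/
def eveSumSNR {Ω : Type*} {N : ℕ} (α : ℝ) (v : Fin (N + 1) → Plane) (p : Fin N → ℝ)
    (X : Fin N → ℕ → Ω → Plane) (S : Fin N → ℕ → Ω → ℝ) (n : Fin N) (ω : Ω) : ℝ :=
  ∑' e, eveSNR α v p X S n e ω

/-- The end-to-end secrecy outage probability of the path at secrecy rate `Rs` under on-off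
transmission: the conditional probability that the smallest hop secrecy capacity is below `Rs`,
given that the smallest SNR at the legitimate receivers exceeds the threshold `2 ^ Rs - 1`. -/
def secrecyOutageProb {Ω : Type*} [MeasurableSpace Ω] {N : ℕ} (P : Measure Ω) (α Rs : ℝ)
    (v : Fin (N + 1) → Plane) (p : Fin N → ℝ)
    (H : Fin N → Ω → ℝ) (X : Fin N → ℕ → Ω → Plane) (S : Fin N → ℕ → Ω → ℝ) : ℝ :=
  (cond P {ω | (2 : ℝ) ^ Rs - 1 < ⨅ n, legitSNR α v p H n ω}).real
    {ω | ⨅ n, Real.logb 2 ((1 + legitSNR α v p H n ω) / (1 + eveSumSNR α v p X S n ω)) < Rs}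

/-- The constant `K₁ = π λ Γ(1 + 2/α) Γ(1 - 2/α)`. -/
def K₁ (α lam : ℝ) : ℝ :=
  Real.pi * lam * Real.Gamma (1 + 2 / α) * Real.Gamma (1 - 2 / α)

end

/-! Solving the SNR inequalities for the fading gain makes both events thresholds on `H n`. Hop `n`
transmits when `a n < H n`, where `a n = (2 ^ Rs - 1) * d ^ α / p n` and `d` is the hop length. It
is then secure exactly when `H n` is at least `a n + T n`, where `T n = 2 ^ Rs * d ^ α * ∑ S / |X| ^
α`, in which the power has cancelled. As `H n` is memoryless and independent of `T n`, the
conditional probability of security is `E exp (-T n)`. The hops are independent, so these factors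
multiply.

Averaging over the gains gives `E exp (-c S) = 1 / (1 + c) = exp (-log (1 + c))`, so given the
positions the transform of `T n` is again the exponential of a sum over points. The Laplace
functional of the Poisson process (`IsHomogeneousPPP.lintegral_expNeg_tsum`) turns it into the
exponential of `-lam * ∫ s / (s + r ^ α)`, and `lintegral_plane_div_add_rpow` evaluates the integral
as a multiple of `s ^ (2 / α)`.

Sums and transforms live in `[0, ∞]`, so no convergence is needed beforehand. Almost sure finiteness
follows afterwards, since the transform tends to `1` at `0`. -/

noncomputable section

open Filter Topology
open scoped ENNReal NNReal

/-! ### The Laplace functional of a Poisson point process. -/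

section

/-- The function `t ↦ exp (-t)` on `[0, ∞]`, with value `0` at `∞`. -/
def expNeg (t : ℝ≥0∞) : ℝ≥0∞ := EReal.exp (-(t : EReal))

lemma expNeg_zero : expNeg 0 = 1 := by simp [expNeg]

lemma expNeg_top : expNeg ⊤ = 0 := by simp [expNeg]

lemma expNeg_ofReal {x : ℝ} (hx : 0 ≤ x) :
    expNeg (ENNReal.ofReal x) = ENNReal.ofReal (Real.exp (-x)) := by
  rw [expNeg, EReal.coe_ennreal_ofReal, max_eq_left hx, ← EReal.coe_neg, EReal.exp_coe]

lemma expNeg_add (s t : ℝ≥0∞) : expNeg (s + t) = expNeg s * expNeg t := by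
  simp only [expNeg, EReal.exp_neg, EReal.coe_ennreal_add, EReal.exp_add]
  exact ENNReal.mul_inv (.inl (by simp)) (.inr (by simp))

lemma antitone_expNeg : Antitone expNeg := fun s t h => by
  apply EReal.exp_monotone
  simpa using h

lemma expNeg_le_one (t : ℝ≥0∞) : expNeg t ≤ 1 :=
  expNeg_zero ▸ antitone_expNeg bot_le

lemma expNeg_ne_top (t : ℝ≥0∞) : expNeg t ≠ ⊤ :=
  ((expNeg_le_one t).trans_lt ENNReal.one_lt_top).ne

lemma continuous_expNeg : Continuous expNeg :=
  ENNReal.continuous_exp.comp (continuous_neg.comp continuous_coe_ennreal_ereal)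

@[fun_prop]
lemma measurable_expNeg : Measurable expNeg := continuous_expNeg.measurable

lemma expNeg_sum {ι : Type*} (s : Finset ι) (f : ι → ℝ≥0∞) :
    expNeg (∑ i ∈ s, f i) = ∏ i ∈ s, expNeg (f i) := by
  classical
  induction s using Finset.induction_on with
  | empty => simp [expNeg_zero]
  | insert a s ha ih => rw [Finset.sum_insert ha, Finset.prod_insert ha, expNeg_add, ih]

lemma expNeg_mul_natCast (c : ℝ≥0∞) (n : ℕ) : expNeg (c * n) = expNeg c ^ n := by
  induction n with
  | zero => simp [expNeg_zero]
  | succ n ih => rw [Nat.cast_succ, mul_add, mul_one, expNeg_add, ih, pow_succ]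

/-- The Laplace transform of a Poisson variable. -/
lemma lintegral_expNeg_poisson (r : ℝ≥0) (c : ℝ≥0∞) :
    ∫⁻ n : ℕ, expNeg (c * n) ∂(poissonMeasure r) = expNeg (r * (1 - expNeg c)) := by
  obtain ⟨y, hy⟩ : ∃ y : ℝ≥0, expNeg c = y := ⟨_, (ENNReal.coe_toNNReal (expNeg_ne_top c)).symm⟩
  have hy1 : y ≤ 1 := by
    have := expNeg_le_one c
    rw [hy] at this
    exact_mod_cast this
  have h1 : (r : ℝ≥0∞) * (1 - expNeg c) = ENNReal.ofReal (r * (1 - y)) := by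
    rw [hy, ← ENNReal.coe_one, ← ENNReal.coe_sub, ← ENNReal.coe_mul, ← ENNReal.ofReal_coe_nnreal]
    congr 1
    push_cast [NNReal.coe_sub hy1]
    ring
  rw [h1, expNeg_ofReal (x := r * (1 - y)) (mul_nonneg r.2 (sub_nonneg.2 (by exact_mod_cast hy1))),
    lintegral_countable']
  have h2 : ∀ n : ℕ, expNeg (c * n) * poissonMeasure r {n} =
      ENNReal.ofReal (Real.exp (-r) * ((r * y) ^ n / n.factorial)) := by
    intro n
    rw [expNeg_mul_natCast, hy, poissonMeasure_singleton, ← ENNReal.ofReal_coe_nnreal,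
      ← ENNReal.ofReal_pow y.coe_nonneg, ← ENNReal.ofReal_mul (pow_nonneg y.coe_nonneg n)]
    congr 1
    rw [mul_pow]
    ring
  simp_rw [h2]
  have h3 : HasSum (fun n : ℕ => Real.exp (-r) * ((r * y : ℝ) ^ n / n.factorial))
      (Real.exp (-r) * Real.exp (r * y)) := by
    rw [Real.exp_eq_exp_ℝ]
    exact (NormedSpace.expSeries_div_hasSum_exp (r * y : ℝ)).mul_left _
  rw [← ENNReal.ofReal_tsum_of_nonneg (fun n => by positivity) h3.summable, h3.tsum_eq,
    ← Real.exp_add]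
  congr 2
  ring

/-- The bridge between counts, whose law is given, and sums over points; it also yields
measurability of the weighted counts. -/
lemma mul_pointCount_eq_tsum {Ω : Type*} (X : ℕ → Ω → Plane) (B : Set Plane) (c : ℝ≥0∞) (ω : Ω) :
    c * (pointCount X B ω : ℝ≥0∞) = ∑' e, B.indicator (fun _ => c) (X e ω) := by
  have : ∀ e, B.indicator (fun _ => c) (X e ω) = {e | X e ω ∈ B}.indicator (fun _ => c) e := by
    intro e
    by_cases h : X e ω ∈ B <;> simp [h]
  simp_rw [this]
  rw [← tsum_subtype, ENNReal.tsum_set_const, mul_comm]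
  rfl

/-- Campbell's sum of a simple function over a point pattern, in terms of point counts. -/
lemma tsum_simpleFunc_eq_sum_pointCount {Ω : Type*} (X : ℕ → Ω → Plane)
    (h : SimpleFunc Plane ℝ≥0∞) (ω : Ω) :
    ∑' e, h (X e ω) = ∑ c ∈ h.range, c * (pointCount X (h ⁻¹' {c}) ω : ℝ≥0∞) := by
  simp_rw [mul_pointCount_eq_tsum]
  rw [← Summable.tsum_finsetSum (fun _ _ => ENNReal.summable)]
  refine tsum_congr fun e => ?_
  rw [Finset.sum_eq_single (h (X e ω))]
  · simp
  · intro c _ hc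
    rw [Set.indicator_of_notMem]
    exact fun h' => hc h'.symm
  · intro h'
    exact absurd (h.mem_range_self _) h'

variable {Ω : Type*} [MeasurableSpace Ω] {P : Measure Ω} {X : ℕ → Ω → Plane} {lam : ℝ}

lemma IsHomogeneousPPP.measurable_mul_pointCount (hX : IsHomogeneousPPP X lam P) {B : Set Plane}
    (hB : MeasurableSet B) (c : ℝ≥0∞) :
    Measurable (fun ω => c * (pointCount X B ω : ℝ≥0∞)) := by
  simp_rw [mul_pointCount_eq_tsum]
  exact Measurable.tsum fun e => (measurable_const.indicator hB).comp (hX.measurable e)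

lemma IsHomogeneousPPP.lintegral_expNeg_pointCount (hX : IsHomogeneousPPP X lam P) {B : Set Plane}
    (hB : MeasurableSet B) (hv : volume B ≠ ⊤) (hlam : 0 ≤ lam) (c : ℝ≥0∞) :
    ∫⁻ ω, expNeg (c * (pointCount X B ω : ℝ≥0∞)) ∂P =
      expNeg (ENNReal.ofReal lam * ((1 - expNeg c) * volume B)) := by
  have hm : Measurable fun k : ℕ∞ => expNeg (c * (k : ℝ≥0∞)) := Measurable.of_discrete
  have hl := hX.law B hB hv
  rw [← lintegral_map' (f := fun k : ℕ∞ => expNeg (c * (k : ℝ≥0∞))) hm.aemeasurable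
    hl.aemeasurable, hl.map_eq, lintegral_map hm Measurable.of_discrete]
  simp only [ENat.toENNReal_coe]
  rw [lintegral_expNeg_poisson]
  congr 1
  have : (((lam * volume.real B).toNNReal : ℝ≥0) : ℝ≥0∞) = ENNReal.ofReal lam * volume B := by
    change ENNReal.ofReal _ = _
    rw [ENNReal.ofReal_mul hlam, measureReal_def, ENNReal.ofReal_toReal hv]
  rw [this]
  ring

/-- The fibres of `h` are disjoint, so their counts are independent and the transform factors into
Poisson transforms. -/
lemma IsHomogeneousPPP.lintegral_expNeg_simpleFunc (hX : IsHomogeneousPPP X lam P)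
    (hlam : 0 ≤ lam) (h : SimpleFunc Plane ℝ≥0∞) (hh : ∀ c ≠ 0, volume (h ⁻¹' {c}) ≠ ⊤) :
    ∫⁻ ω, expNeg (∑' e, h (X e ω)) ∂P =
      expNeg (ENNReal.ofReal lam * ∫⁻ x, (1 - expNeg (h x))) := by
  simp_rw [tsum_simpleFunc_eq_sum_pointCount, expNeg_sum]
  have hind : iIndepFun (fun (c : h.range) ω =>
      expNeg ((c : ℝ≥0∞) * (pointCount X (h ⁻¹' {(c : ℝ≥0∞)}) ω : ℝ≥0∞))) P := by
    let e := h.range.equivFin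
    have h1 := hX.indep h.range.card (fun i => h ⁻¹' {((e.symm i : h.range) : ℝ≥0∞)})
      (fun i => h.measurableSet_fiber _) (by
        intro i j hij
        refine Disjoint.preimage _ (Set.disjoint_singleton.2 fun h' => hij ?_)
        exact e.symm.injective (Subtype.ext h'))
    have h2 := h1.precomp e.injective
    simp only [Equiv.symm_apply_apply] at h2
    exact h2.comp (fun (c : h.range) (k : ℕ∞) => expNeg ((c : ℝ≥0∞) * (k : ℝ≥0∞)))
      (fun _ => Measurable.of_discrete)
  have hprod := lintegral_prod_eq_prod_lintegral_of_indepFun Finset.univ _ hind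
    (fun c => measurable_expNeg.comp
      (hX.measurable_mul_pointCount (h.measurableSet_fiber _) _))
  simp_rw [← Finset.prod_coe_sort h.range]
  have hint : ∫⁻ x, (1 - expNeg (h x)) = ∑ c ∈ h.range, (1 - expNeg c) * volume (h ⁻¹' {c}) := by
    rw [← SimpleFunc.map_lintegral (fun c => 1 - expNeg c), ← SimpleFunc.lintegral_eq_lintegral]
    rfl
  rw [hprod, hint, Finset.mul_sum, expNeg_sum, ← Finset.prod_coe_sort h.range]
  refine Finset.prod_congr rfl fun c _ => ?_
  -- The zero fibre may have infinite area, where the law is silent; its factor is `1` on both sides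
  -- because `P` has mass one, which the law of the count of `∅` shows.
  by_cases hc : (c : ℝ≥0∞) = 0
  · have : IsProbabilityMeasure P := by
      have := hX.law ∅ .empty (by simp)
      have h3 : P.map (pointCount X ∅) Set.univ = 1 := by
        rw [this.map_eq, Measure.map_apply Measurable.of_discrete .univ]
        simp
      rw [Measure.map_apply_of_aemeasurable this.aemeasurable .univ] at h3
      exact ⟨h3⟩
    simp [hc, expNeg_zero]
  · exact hX.lintegral_expNeg_pointCount (h.measurableSet_fiber _) (hh _ hc) hlam _

/-- The Laplace functional of a homogeneous Poisson point process. -/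
theorem IsHomogeneousPPP.lintegral_expNeg_tsum (hX : IsHomogeneousPPP X lam P)
    [IsProbabilityMeasure P]
    (hlam : 0 ≤ lam) {h : Plane → ℝ≥0∞} (hh : Measurable h) :
    ∫⁻ ω, expNeg (∑' e, h (X e ω)) ∂P =
      expNeg (ENNReal.ofReal lam * ∫⁻ x, (1 - expNeg (h x))) := by
  -- Cutting off to balls gives the nonzero fibres finite area and keeps the approximation
  -- increasing.
  let g : ℕ → SimpleFunc Plane ℝ≥0∞ := fun k =>
    (SimpleFunc.eapprox h k).restrict (Metric.ball 0 k)
  have hg : ∀ k x, g k x = (Metric.ball 0 (k : ℝ)).indicator (SimpleFunc.eapprox h k) x :=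
    fun k x => SimpleFunc.restrict_apply _ measurableSet_ball x
  have hmono : ∀ x, Monotone fun k => g k x := by
    intro x k l hkl
    simp only [hg]
    refine (Set.indicator_le_indicator (SimpleFunc.monotone_eapprox h hkl x)).trans ?_
    exact Set.indicator_le_indicator_of_subset
      (Metric.ball_subset_ball (by exact_mod_cast hkl)) (fun _ => bot_le) x
  have hlim : ∀ x, Tendsto (fun k => g k x) atTop (𝓝 (h x)) := by
    intro x
    refine (SimpleFunc.tendsto_eapprox hh x).congr' ?_
    obtain ⟨m, hm⟩ := exists_nat_gt ‖x‖
    filter_upwards [eventually_ge_atTop m] with k hk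
    rw [hg, Set.indicator_of_mem]
    rw [mem_ball_zero_iff]
    exact hm.trans_le (by exact_mod_cast hk)
  have hsum : ∀ ω, Tendsto (fun k => ∑' e, g k (X e ω)) atTop (𝓝 (∑' e, h (X e ω))) := by
    intro ω
    -- A sum over points is an integral against counting measure, so monotone convergence applies.
    simp_rw [← lintegral_count]
    exact lintegral_tendsto_of_tendsto_of_monotone
      (fun k => (measurable_of_countable _).aemeasurable)
      (ae_of_all _ fun e => hmono _) (ae_of_all _ fun e => hlim _)
  have hL : Tendsto (fun k => ∫⁻ ω, expNeg (∑' e, g k (X e ω)) ∂P) atTop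
      (𝓝 (∫⁻ ω, expNeg (∑' e, h (X e ω)) ∂P)) := by
    refine tendsto_lintegral_of_dominated_convergence (fun _ => 1) (fun k => ?_)
      (fun k => ae_of_all _ fun ω => expNeg_le_one _) (by simp)
      (ae_of_all _ fun ω => (continuous_expNeg.tendsto _).comp (hsum ω))
    exact measurable_expNeg.comp
      (Measurable.tsum fun e => (g k).measurable.comp (hX.measurable e))
  have hR : Tendsto (fun k => ∫⁻ x, (1 - expNeg (g k x))) atTop
      (𝓝 (∫⁻ x, (1 - expNeg (h x)))) := by
    refine lintegral_tendsto_of_tendsto_of_monotone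
      (fun k => (measurable_const.sub (measurable_expNeg.comp (g k).measurable)).aemeasurable)
      (ae_of_all _ fun x k l hkl => tsub_le_tsub_left (antitone_expNeg (hmono x hkl)) _)
      (ae_of_all _ fun x => ?_)
    exact ENNReal.Tendsto.sub tendsto_const_nhds ((continuous_expNeg.tendsto _).comp (hlim x))
      (Or.inl (by simp))
  refine tendsto_nhds_unique hL ?_
  have hR' := (continuous_expNeg.tendsto _).comp
    (ENNReal.Tendsto.const_mul (a := ENNReal.ofReal lam) hR (Or.inr ENNReal.ofReal_ne_top))
  refine hR'.congr fun k => (hX.lintegral_expNeg_simpleFunc hlam (g k) fun c hc => ?_).symm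
  refine ((measure_mono ?_).trans_lt (measure_ball_lt_top (x := (0 : Plane)) (r := k))).ne
  intro x hx
  by_contra hx'
  apply hc
  rw [← show g k x = c from hx, hg, Set.indicator_of_notMem hx']

end

/-! ### The area integral and the Laplace transform of the interference. -/

section

lemma lintegral_rpow_mul_exp_neg_mul_Ioi {a r : ℝ} (ha : 0 < a) (hr : 0 < r) :
    ∫⁻ t in Set.Ioi (0 : ℝ), ENNReal.ofReal (t ^ (a - 1) * Real.exp (-(r * t))) =
      ENNReal.ofReal ((1 / r) ^ a * Real.Gamma a) := by
  have h := Real.integral_rpow_mul_exp_neg_mul_Ioi ha hr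
  have hpos : 0 < (1 / r) ^ a * Real.Gamma a :=
    mul_pos (Real.rpow_pos_of_pos (by positivity) _) (Real.Gamma_pos_of_pos ha)
  -- A nonintegrable function has Bochner integral `0`, so a positive value forces integrability.
  rw [← h, ofReal_integral_eq_lintegral_ofReal (.of_integral_ne_zero (by rw [h]; exact hpos.ne'))]
  filter_upwards [ae_restrict_mem measurableSet_Ioi] with t ht
  have : (0 : ℝ) < t := ht
  positivity

/-- The corresponding integral over `ℂ`, carried to `Plane` by a measure-preserving isometry. -/
lemma lintegral_plane_exp_neg_mul_rpow {α t : ℝ} (hα : 1 ≤ α) (ht : 0 < t) :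
    ∫⁻ x : Plane, ENNReal.ofReal (Real.exp (-t * ‖x‖ ^ α)) =
      ENNReal.ofReal (Real.pi * t ^ (-2 / α) * Real.Gamma (2 / α + 1)) := by
  have h := Complex.integral_exp_neg_mul_rpow hα ht
  have hpos : 0 < Real.pi * t ^ (-2 / α) * Real.Gamma (2 / α + 1) :=
    mul_pos (mul_pos Real.pi_pos (Real.rpow_pos_of_pos ht _))
      (Real.Gamma_pos_of_pos (by positivity))
  rw [← h, ofReal_integral_eq_lintegral_ofReal (.of_integral_ne_zero (by rw [h]; exact hpos.ne'))
    (ae_of_all _ fun _ => (Real.exp_pos _).le),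
    ← Complex.orthonormalBasisOneI.measurePreserving_repr.lintegral_comp (by fun_prop)]
  simp

/-- The area integral in the exponent of the Laplace transform of Poisson interference. -/
lemma lintegral_plane_div_add_rpow {α s : ℝ} (hα : 2 < α) (hs : 0 < s) (u : Plane) :
    ∫⁻ x : Plane, ENNReal.ofReal (s / (s + dist u x ^ α)) =
      ENNReal.ofReal
        (Real.pi * Real.Gamma (1 + 2 / α) * Real.Gamma (1 - 2 / α) * s ^ (2 / α)) := by
  have hα0 : 0 < α := by linarith
  have h2α : 2 / α < 1 := by rw [div_lt_one hα0]; exact hα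
  -- Writing the kernel as a mixture of `exp (-t * r ^ α)` lets Tonelli integrate over the plane
  -- first. What remains is a Gamma integral with parameter `1 - 2 / α`, positive because `2 < α`.
  have hker : ∀ r : ℝ, 0 ≤ r → ENNReal.ofReal (s / (s + r ^ α)) =
      ∫⁻ t in Set.Ioi (0 : ℝ), ENNReal.ofReal (s * Real.exp (-(s * t))) *
        ENNReal.ofReal (Real.exp (-t * r ^ α)) := by
    intro r hr
    have hpos : 0 < s + r ^ α := by positivity
    have := lintegral_rpow_mul_exp_neg_mul_Ioi one_pos hpos
    simp only [sub_self, Real.rpow_zero, one_mul, Real.rpow_one, Real.Gamma_one, mul_one] at this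
    rw [div_eq_mul_one_div, ENNReal.ofReal_mul hs.le, ← this,
      ← lintegral_const_mul _ (by fun_prop)]
    refine lintegral_congr fun t => ?_
    rw [← ENNReal.ofReal_mul hs.le, ← ENNReal.ofReal_mul (by positivity), mul_assoc, ← Real.exp_add]
    congr 3
    ring
  simp_rw [dist_eq_norm]
  rw [lintegral_sub_left_eq_self (fun x : Plane => ENNReal.ofReal (s / (s + ‖x‖ ^ α))) u]
  simp_rw [hker _ (norm_nonneg _)]
  rw [lintegral_lintegral_swap (by fun_prop)]
  have hin : ∀ t ∈ Set.Ioi (0 : ℝ), ∫⁻ x : Plane, ENNReal.ofReal (s * Real.exp (-(s * t))) *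
      ENNReal.ofReal (Real.exp (-t * ‖x‖ ^ α)) =
      ENNReal.ofReal (s * Real.pi * Real.Gamma (1 + 2 / α)) *
        ENNReal.ofReal (t ^ ((1 - 2 / α) - 1) * Real.exp (-(s * t))) := by
    intro t ht
    have hG : 0 < Real.Gamma (1 + 2 / α) := Real.Gamma_pos_of_pos (by positivity)
    rw [lintegral_const_mul _ (by fun_prop),
      lintegral_plane_exp_neg_mul_rpow (by linarith) ht, ← ENNReal.ofReal_mul (by positivity),
      ← ENNReal.ofReal_mul (by positivity), add_comm (2 / α) 1,
      show 1 - 2 / α - 1 = -2 / α by ring]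
    congr 1
    ac_rfl
  rw [setLIntegral_congr_fun measurableSet_Ioi hin, lintegral_const_mul _ (by fun_prop),
    lintegral_rpow_mul_exp_neg_mul_Ioi (by linarith) hs,
    ← ENNReal.ofReal_mul (mul_nonneg (by positivity) (Real.Gamma_pos_of_pos (by positivity)).le)]
  congr 1
  rw [one_div, Real.inv_rpow hs.le, ← Real.rpow_neg hs.le, neg_sub, Real.rpow_sub hs,
    Real.rpow_one]
  field_simp

lemma expMeasure_eq_withDensity (r : ℝ) :
    expMeasure r = volume.withDensity (exponentialPDF r) := rfl

/-- The Laplace transform of an exponential variable. -/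
lemma lintegral_expNeg_expMeasure {c : ℝ} (hc : 0 ≤ c) :
    ∫⁻ x, expNeg (ENNReal.ofReal (c * x)) ∂(expMeasure 1) =
      expNeg (ENNReal.ofReal (Real.log (1 + c))) := by
  have h1 : (0 : ℝ) < 1 + c := by positivity
  have hm : ∀ r, Measurable (exponentialPDF r) := fun r =>
    (measurable_exponentialPDFReal r).ennreal_ofReal
  rw [expMeasure_eq_withDensity, lintegral_withDensity_eq_lintegral_mul _ (hm 1) (by fun_prop),
    expNeg_ofReal (Real.log_nonneg (by linarith)), Real.exp_neg, Real.exp_log h1]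
  have : ∀ x : ℝ, (exponentialPDF 1 * fun x => expNeg (ENNReal.ofReal (c * x))) x =
      ENNReal.ofReal (1 + c)⁻¹ * exponentialPDF (1 + c) x := by
    intro x
    rw [Pi.mul_apply]
    rcases lt_or_ge x 0 with hx | hx
    · simp [exponentialPDF_of_neg hx]
    · rw [exponentialPDF_of_nonneg hx, exponentialPDF_of_nonneg hx,
        expNeg_ofReal (mul_nonneg hc hx), ← ENNReal.ofReal_mul (by positivity),
        ← ENNReal.ofReal_mul (by positivity), ← mul_assoc, inv_mul_cancel₀ h1.ne', one_mul,
        one_mul, ← Real.exp_add]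
      congr 2
      ring_nf
  rw [lintegral_congr this, lintegral_const_mul _ (hm _), lintegral_exponentialPDF_eq_one h1,
    mul_one]

lemma tendsto_expNeg_sum_range (f : ℕ → ℝ≥0∞) :
    Tendsto (fun n => ∏ e ∈ Finset.range n, expNeg (f e)) atTop (𝓝 (expNeg (∑' e, f e))) := by
  simp_rw [← expNeg_sum]
  exact (continuous_expNeg.tendsto _).comp (ENNReal.tendsto_nat_tsum f)

variable {Ω : Type*} [MeasurableSpace Ω] {P : Measure Ω} [IsProbabilityMeasure P]

/-- The Laplace transform of a weighted sum of independent exponential variables. -/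
lemma lintegral_expNeg_tsum_exponential {S : ℕ → Ω → ℝ} (hS : ∀ e, Measurable (S e))
    (hlaw : ∀ e, HasLaw (S e) (expMeasure 1) P) (hind : iIndepFun S P)
    {c : ℕ → ℝ} (hc : ∀ e, 0 ≤ c e) :
    ∫⁻ ω, expNeg (∑' e, ENNReal.ofReal (c e * S e ω)) ∂P =
      expNeg (∑' e, ENNReal.ofReal (Real.log (1 + c e))) := by
  have hfin : ∀ n, ∫⁻ ω, ∏ e ∈ Finset.range n, expNeg (ENNReal.ofReal (c e * S e ω)) ∂P =
      ∏ e ∈ Finset.range n, expNeg (ENNReal.ofReal (Real.log (1 + c e))) := by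
    intro n
    rw [lintegral_prod_eq_prod_lintegral_of_indepFun (Finset.range n)
      (fun e ω => expNeg (ENNReal.ofReal (c e * S e ω)))
      (hind.comp (fun e x => expNeg (ENNReal.ofReal (c e * x))) (fun e => by fun_prop))
      (fun e => by fun_prop)]
    refine Finset.prod_congr rfl fun e _ => ?_
    rw [← lintegral_expNeg_expMeasure (hc e), ← (hlaw e).map_eq,
      lintegral_map (by fun_prop) (hS e)]
  refine tendsto_nhds_unique ?_ (tendsto_expNeg_sum_range _)
  simp_rw [← hfin]
  refine tendsto_lintegral_of_dominated_convergence (fun _ => 1) (fun n => by fun_prop)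
    (fun n => ae_of_all _ fun ω => ?_) (by simp) (ae_of_all _ fun ω => tendsto_expNeg_sum_range _)
  exact Finset.prod_le_one' fun e _ => expNeg_le_one _

/-- The interference at `u`, scaled by `s`, as a function of the positions and gains. -/
def interference (α s : ℝ) (u : Plane) (q : (ℕ → Plane) × (ℕ → ℝ)) : ℝ≥0∞ :=
  ∑' e, ENNReal.ofReal (s / dist u (q.1 e) ^ α * q.2 e)

@[fun_prop]
lemma measurable_interference (α s : ℝ) (u : Plane) : Measurable (interference α s u) := by
  unfold interference
  fun_prop

/-- The Laplace transform of the interference of a Poisson field with Rayleigh fading. -/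
theorem lintegral_expNeg_interference {α s lam : ℝ} (hα : 2 < α) (hs : 0 < s) (hlam : 0 ≤ lam)
    (u : Plane) {X : ℕ → Ω → Plane} {S : ℕ → Ω → ℝ} (hX : IsHomogeneousPPP X lam P)
    (hS : ∀ e, Measurable (S e)) (hlaw : ∀ e, HasLaw (S e) (expMeasure 1) P)
    (hind : iIndepFun S P) (hXS : IndepFun (fun ω e => X e ω) (fun ω e => S e ω) P) :
    ∫⁻ ω, expNeg (interference α s u (fun e => X e ω, fun e => S e ω)) ∂P =
      expNeg (ENNReal.ofReal (K₁ α lam * s ^ (2 / α))) := by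
  have hXm : Measurable (fun ω e => X e ω) := measurable_pi_lambda _ hX.measurable
  have hSm : Measurable (fun ω e => S e ω) := measurable_pi_lambda _ hS
  have hprod := hXS.map_prod_eq_prod_map_map hXm.aemeasurable hSm.aemeasurable
  have hmeas : Measurable fun q : (ℕ → Plane) × (ℕ → ℝ) => expNeg (interference α s u q) := by
    fun_prop
  -- With the positions frozen, only the gains are averaged.
  have hinner : ∀ x : ℕ → Plane, ∫⁻ z, expNeg (interference α s u (x, z))
      ∂(P.map fun ω e => S e ω) =
        expNeg (∑' e, ENNReal.ofReal (Real.log (1 + s / dist u (x e) ^ α))) := by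
    intro x
    rw [lintegral_map (f := fun z => expNeg (interference α s u (x, z)))
      (hmeas.comp measurable_prodMk_left) hSm]
    exact lintegral_expNeg_tsum_exponential hS hlaw hind
      (c := fun e => s / dist u (x e) ^ α) (fun e => by positivity)
  rw [← lintegral_map (μ := P) (g := fun ω => (fun e => X e ω, fun e => S e ω)) hmeas
      (hXm.prodMk hSm), hprod,
    lintegral_prod _ hmeas.aemeasurable, lintegral_congr hinner, lintegral_map (by fun_prop) hXm,
    hX.lintegral_expNeg_tsum hlam
      (h := fun x => ENNReal.ofReal (Real.log (1 + s / dist u x ^ α))) (by fun_prop)]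
  -- At `x = u` division by zero makes the left side `0` and the right side `1`; a single point is
  -- null.
  have hae : (fun x : Plane =>
      1 - expNeg (ENNReal.ofReal (Real.log (1 + s / dist u x ^ α)))) =ᵐ[volume]
      fun x => ENNReal.ofReal (s / (s + dist u x ^ α)) := by
    filter_upwards [compl_mem_ae_iff.2 (measure_singleton u)] with x hx
    have hd : 0 < dist u x ^ α := Real.rpow_pos_of_pos (dist_pos.2 (Ne.symm hx)) _
    have hq : 0 < s / dist u x ^ α := by positivity
    rw [expNeg_ofReal (Real.log_nonneg (by linarith)), Real.exp_neg, Real.exp_log (by linarith),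
      ← ENNReal.ofReal_one, ← ENNReal.ofReal_sub _ (by positivity)]
    congr 1
    field_simp
    ring
  rw [lintegral_congr_ae hae, lintegral_plane_div_add_rpow hα hs, ← ENNReal.ofReal_mul hlam, K₁]
  congr 2
  ring

end

/-! ### Exponential thresholds and finiteness from the Laplace transform. -/

section

lemma expMeasure_Ioi {x : ℝ} (hx : 0 ≤ x) :
    expMeasure 1 (Set.Ioi x) = ENNReal.ofReal (Real.exp (-x)) := by
  have := isProbabilityMeasure_expMeasure one_pos
  rw [← Set.compl_Iic, prob_compl_eq_one_sub measurableSet_Iic, ← ofReal_cdf,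
    cdf_expMeasure_eq one_pos, if_pos hx, ← ENNReal.ofReal_one, ← ENNReal.ofReal_sub _ (by simp [hx])]
  simp

lemma expMeasure_Ici {x : ℝ} (hx : 0 ≤ x) :
    expMeasure 1 (Set.Ici x) = ENNReal.ofReal (Real.exp (-x)) := by
  have h0 : expMeasure 1 {x} = 0 :=
    withDensity_absolutelyContinuous _ _ (measure_singleton x)
  rw [← Set.Ioi_insert, Set.insert_eq, ← expMeasure_Ioi hx]
  exact measure_congr (union_ae_eq_right_of_ae_eq_empty (ae_eq_empty.2 h0))

/-- Memorylessness, `exp (-(a + t)) = exp (-a) * exp (-t)`. For finite `t` the set lies between the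
open and the closed half-line at `a + t`, which have equal mass. -/
lemma expMeasure_setOf_lt_and_add_le {a : ℝ} (ha : 0 ≤ a) (t : ℝ≥0∞) :
    expMeasure 1 {x | a < x ∧ ENNReal.ofReal a + t ≤ ENNReal.ofReal x} =
      ENNReal.ofReal (Real.exp (-a)) * expNeg t := by
  induction t with
  | top => simp [expNeg_top]
  | coe t =>
    -- `ENNReal.ofReal` clips negative `x` to `0`; the resulting second alternative is incompatible
    -- with `a < x`.
    have hset : ∀ x, ENNReal.ofReal a + t ≤ ENNReal.ofReal x ↔ a + t ≤ x ∨ (a + t = 0 ∧ x ≤ 0) := by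
      intro x
      rw [← ENNReal.ofReal_coe_nnreal, ← ENNReal.ofReal_add ha t.coe_nonneg]
      rcases le_total x 0 with hx | hx
      · have := t.coe_nonneg
        rw [ENNReal.ofReal_of_nonpos hx, nonpos_iff_eq_zero, ENNReal.ofReal_eq_zero]
        constructor
        · intro h; right; exact ⟨by linarith, hx⟩
        · rintro (h | h) <;> linarith [h]
      · rw [ENNReal.ofReal_le_ofReal_iff hx]
        constructor
        · exact .inl
        · rintro (h | h)
          · exact h
          · linarith [h.1]
    have hat : 0 ≤ a + t := add_nonneg ha t.coe_nonneg
    rw [← ENNReal.ofReal_coe_nnreal, expNeg_ofReal t.coe_nonneg,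
      ← ENNReal.ofReal_mul (Real.exp_pos _).le, ← Real.exp_add, ← neg_add]
    simp only [ENNReal.ofReal_coe_nnreal]
    refine le_antisymm ((measure_mono ?_).trans_eq (expMeasure_Ici hat))
      ((expMeasure_Ioi hat).symm.trans_le (measure_mono ?_))
    · rintro x ⟨h1, h2⟩
      rcases (hset x).1 h2 with h | h
      · exact h
      · linarith [h.1, h.2, t.coe_nonneg]
    · intro x hx
      have hx' : a + t < x := hx
      exact ⟨by linarith [t.coe_nonneg], (hset x).2 (.inl hx'.le)⟩

lemma measurableSet_lt_and_add_le (a : ℝ) :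
    MeasurableSet {q : ℝ≥0∞ × ℝ | a < q.2 ∧ ENNReal.ofReal a + q.1 ≤ ENNReal.ofReal q.2} := by
  have h : Measurable fun q : ℝ≥0∞ × ℝ => ENNReal.ofReal a + q.1 := by fun_prop
  exact (measurableSet_lt measurable_const measurable_snd).inter
    (measurableSet_le h measurable_snd.ennreal_ofReal)

lemma ae_nonneg_of_hasLaw_expMeasure {Ω : Type*} [MeasurableSpace Ω] {P : Measure Ω}
    {H : Ω → ℝ} (h : HasLaw H (expMeasure 1) P) : ∀ᵐ ω ∂P, 0 ≤ H ω := by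
  have := isProbabilityMeasure_expMeasure one_pos
  have h1 : ∀ᵐ x ∂(expMeasure 1), (0 : ℝ) ≤ x := by
    refine (prob_compl_eq_zero_iff (measurableSet_Ici (a := (0 : ℝ)))).2 ?_
    rw [expMeasure_Ici le_rfl]
    simp
  rw [← h.map_eq] at h1
  exact ae_of_ae_map h.aemeasurable h1

variable {Ω : Type*} [MeasurableSpace Ω] {P : Measure Ω} [IsProbabilityMeasure P]

/-- The probability that an exponential variable exceeds a threshold raised by an independent
amount. -/
lemma measure_lt_and_add_le {H : Ω → ℝ} {T : Ω → ℝ≥0∞} (hH : Measurable H) (hT : Measurable T)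
    (hlaw : HasLaw H (expMeasure 1) P) (hind : IndepFun T H P) {a : ℝ} (ha : 0 ≤ a) :
    P {ω | a < H ω ∧ ENNReal.ofReal a + T ω ≤ ENNReal.ofReal (H ω)} =
      ENNReal.ofReal (Real.exp (-a)) * ∫⁻ ω, expNeg (T ω) ∂P := by
  have := isProbabilityMeasure_expMeasure one_pos
  have hprod := hind.map_prod_eq_prod_map_map hT.aemeasurable hH.aemeasurable
  rw [hlaw.map_eq] at hprod
  have hG := measurableSet_lt_and_add_le a
  change P ((fun ω => (T ω, H ω)) ⁻¹'
    {q | a < q.2 ∧ ENNReal.ofReal a + q.1 ≤ ENNReal.ofReal q.2}) = _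
  rw [← Measure.map_apply (hT.prodMk hH) hG, hprod, Measure.prod_apply hG]
  have : ∀ t : ℝ≥0∞, expMeasure 1 (Prod.mk t ⁻¹'
      {q : ℝ≥0∞ × ℝ | a < q.2 ∧ ENNReal.ofReal a + q.1 ≤ ENNReal.ofReal q.2}) =
      ENNReal.ofReal (Real.exp (-a)) * expNeg t := fun t => expMeasure_setOf_lt_and_add_le ha t
  simp_rw [this]
  rw [lintegral_const_mul _ measurable_expNeg, lintegral_map measurable_expNeg hT]

/-- A variable in `[0, ∞]` is almost surely finite if its Laplace transform tends to `1` at `0`. -/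
lemma ae_ne_top_of_lintegral_expNeg {T : Ω → ℝ≥0∞} (hT : Measurable T)
    {c : ℕ → ℝ≥0∞} (hc0 : ∀ k, c k ≠ 0)
    (hlim : Tendsto (fun k => ∫⁻ ω, expNeg (c k * T ω) ∂P) atTop (𝓝 1)) :
    ∀ᵐ ω ∂P, T ω ≠ ⊤ := by
  have hm : MeasurableSet {ω | T ω ≠ ⊤} := (hT (measurableSet_singleton ⊤)).compl
  -- Where `T = ⊤` the integrand vanishes, since `c k ≠ 0`; elsewhere it is at most `1`.
  have hle : ∀ k, ∫⁻ ω, expNeg (c k * T ω) ∂P ≤ P {ω | T ω ≠ ⊤} := by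
    intro k
    rw [← lintegral_indicator_one hm]
    refine lintegral_mono fun ω => ?_
    by_cases h : T ω = ⊤
    · simp [h, ENNReal.mul_top (hc0 k), expNeg_top]
    · rw [Set.indicator_of_mem (by exact h)]
      exact expNeg_le_one _
  exact (prob_compl_eq_zero_iff hm).2 (le_antisymm prob_le_one (le_of_tendsto' hlim hle))

end

lemma ofReal_mul_interference (α : ℝ) {c : ℝ} (hc : 0 ≤ c) (s : ℝ) (u : Plane)
    (q : (ℕ → Plane) × (ℕ → ℝ)) :
    ENNReal.ofReal c * interference α s u q = interference α (c * s) u q := by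
  rw [interference, interference, ← ENNReal.tsum_mul_left]
  refine tsum_congr fun e => ?_
  rw [← ENNReal.ofReal_mul hc]
  congr 1
  ring

/-- Scaling by `1 / (k + 1)` only rescales `s`, so the explicit transform tends to `expNeg 0 = 1`.
-/
lemma ae_interference_ne_top {Ω : Type*} [MeasurableSpace Ω] {P : Measure Ω}
    [IsProbabilityMeasure P] {α s lam : ℝ} (hα : 2 < α) (hs : 0 < s) (hlam : 0 ≤ lam)
    (u : Plane) {X : ℕ → Ω → Plane} {S : ℕ → Ω → ℝ} (hX : IsHomogeneousPPP X lam P)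
    (hS : ∀ e, Measurable (S e)) (hlaw : ∀ e, HasLaw (S e) (expMeasure 1) P)
    (hind : iIndepFun S P) (hXS : IndepFun (fun ω e => X e ω) (fun ω e => S e ω) P) :
    ∀ᵐ ω ∂P, interference α s u (fun e => X e ω, fun e => S e ω) ≠ ⊤ := by
  have hm : Measurable fun ω => ((fun e => X e ω, fun e => S e ω) : (ℕ → Plane) × (ℕ → ℝ)) :=
    (measurable_pi_lambda _ hX.measurable).prodMk (measurable_pi_lambda _ hS)
  have hα0 : 0 < α := by linarith
  have hc : ∀ k : ℕ, (0 : ℝ) < 1 / ((k : ℝ) + 1) := fun k => by positivity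
  refine ae_ne_top_of_lintegral_expNeg ((measurable_interference α s u).comp hm)
    (c := fun k : ℕ => ENNReal.ofReal (1 / ((k : ℝ) + 1)))
    (fun k => (ENNReal.ofReal_pos.2 (hc k)).ne') ?_
  simp_rw [ofReal_mul_interference α (hc _).le,
    lintegral_expNeg_interference hα (mul_pos (hc _) hs) hlam u hX hS hlaw hind hXS]
  rw [← expNeg_zero]
  refine (continuous_expNeg.tendsto _).comp ?_
  rw [← ENNReal.ofReal_zero]
  refine ENNReal.tendsto_ofReal ?_
  have h1 : Tendsto (fun k : ℕ => 1 / ((k : ℝ) + 1) * s) atTop (𝓝 0) := by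
    simpa using tendsto_one_div_add_atTop_nhds_zero_nat.mul_const s
  have h2 := (h1.rpow_const (p := 2 / α) (Or.inr (by positivity))).const_mul (K₁ α lam)
  rwa [Real.zero_rpow (by positivity), mul_zero] at h2

/-! ### Secrecy of a single hop as a condition on its fading gain. -/

section Hop

variable {Ω : Type*} {N : ℕ} {α : ℝ} {v : Fin (N + 1) → Plane} {p : Fin N → ℝ}
  {H : Fin N → Ω → ℝ} {X : Fin N → ℕ → Ω → Plane} {S : Fin N → ℕ → Ω → ℝ} {n : Fin N} {ω : Ω}

lemma hopDist_pos (hv : v n.castSucc ≠ v n.succ) : 0 < hopDist v n := dist_pos.2 hv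

lemma eveSNR_nonneg (hp : 0 < p n) (hS : ∀ e, 0 ≤ S n e ω) (e : ℕ) :
    0 ≤ eveSNR α v p X S n e ω := by
  have := hS e
  unfold eveSNR
  positivity

/-- The left side does not involve `p`: this is where the transmit power cancels. -/
lemma interference_eq_tsum_eveSNR (hp : 0 < p n) {s : ℝ} (hs : 0 < s) :
    interference α s (v n.castSucc) (fun e => X n e ω, fun e => S n e ω) =
      ENNReal.ofReal (s / p n) * ∑' e, ENNReal.ofReal (eveSNR α v p X S n e ω) := by
  rw [interference, ← ENNReal.tsum_mul_left]
  refine tsum_congr fun e => ?_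
  rw [← ENNReal.ofReal_mul (by positivity), eveSNR]
  congr 1
  field_simp

lemma summable_eveSNR (hp : 0 < p n) {s : ℝ} (hs : 0 < s) (hS : ∀ e, 0 ≤ S n e ω)
    (hfin : interference α s (v n.castSucc) (fun e => X n e ω, fun e => S n e ω) ≠ ⊤) :
    Summable fun e => eveSNR α v p X S n e ω := by
  rw [interference_eq_tsum_eveSNR (v := v) hp hs] at hfin
  have hne : ENNReal.ofReal (s / p n) ≠ 0 := (ENNReal.ofReal_pos.2 (by positivity)).ne'
  have h : ∑' e, ENNReal.ofReal (eveSNR α v p X S n e ω) ≠ ⊤ := fun h' =>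
    hfin (by rw [h', ENNReal.mul_top hne])
  simpa only [ENNReal.toReal_ofReal (eveSNR_nonneg hp hS _)] using ENNReal.summable_toReal h

/-- Finiteness matters: a divergent real `tsum` would be `0` instead of `⊤`. -/
lemma interference_eq_eveSumSNR (hp : 0 < p n) {s : ℝ} (hs : 0 < s) (hS : ∀ e, 0 ≤ S n e ω)
    (hfin : interference α s (v n.castSucc) (fun e => X n e ω, fun e => S n e ω) ≠ ⊤) :
    interference α s (v n.castSucc) (fun e => X n e ω, fun e => S n e ω) =
      ENNReal.ofReal (s / p n * eveSumSNR α v p X S n ω) := by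
  rw [interference_eq_tsum_eveSNR (v := v) hp hs, eveSumSNR, ENNReal.ofReal_mul (by positivity),
    ENNReal.ofReal_tsum_of_nonneg (eveSNR_nonneg hp hS) (summable_eveSNR hp hs hS hfin)]

lemma lt_legitSNR_iff (hp : 0 < p n) (hv : v n.castSucc ≠ v n.succ) (γ : ℝ) :
    γ < legitSNR α v p H n ω ↔ γ * hopDist v n ^ α / p n < H n ω := by
  have hd := Real.rpow_pos_of_pos (hopDist_pos hv) α
  rw [legitSNR, lt_div_iff₀ hd, div_lt_iff₀ hp, mul_comm (H n ω)]

/-- A hop is secure exactly when its fading gain exceeds the threshold raised by the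
interference. -/
lemma logb_secrecy_lt_iff (hp : 0 < p n) (hv : v n.castSucc ≠ v n.succ) {Rs : ℝ} (hRs : 0 ≤ Rs)
    (hS : ∀ e, 0 ≤ S n e ω)
    (hfin : interference α (2 ^ Rs * hopDist v n ^ α) (v n.castSucc)
      (fun e => X n e ω, fun e => S n e ω) ≠ ⊤)
    (hH : (2 ^ Rs - 1) * hopDist v n ^ α / p n < H n ω) :
    Real.logb 2 ((1 + legitSNR α v p H n ω) / (1 + eveSumSNR α v p X S n ω)) < Rs ↔
      ¬ ENNReal.ofReal ((2 ^ Rs - 1) * hopDist v n ^ α / p n) +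
        interference α (2 ^ Rs * hopDist v n ^ α) (v n.castSucc)
          (fun e => X n e ω, fun e => S n e ω) ≤ ENNReal.ofReal (H n ω) := by
  have hd := Real.rpow_pos_of_pos (hopDist_pos hv) α
  have h2 : (0 : ℝ) < 2 ^ Rs := by positivity
  have hγ : (0 : ℝ) ≤ 2 ^ Rs - 1 := by
    have := Real.one_le_rpow one_le_two hRs
    linarith
  have hsum : 0 ≤ eveSumSNR α v p X S n ω := tsum_nonneg (eveSNR_nonneg hp hS)
  have ha : 0 ≤ (2 ^ Rs - 1) * hopDist v n ^ α / p n := by positivity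
  rw [interference_eq_eveSumSNR hp (by positivity) hS hfin,
    ← ENNReal.ofReal_add ha (by positivity), ENNReal.ofReal_le_ofReal_iff (ha.trans hH.le), not_le]
  have hL : 0 < legitSNR α v p H n ω := hγ.trans_lt ((lt_legitSNR_iff hp hv _).2 hH)
  rw [Real.logb_lt_iff_lt_rpow one_lt_two (by positivity), div_lt_iff₀ (by positivity),
    legitSNR]
  set T := eveSumSNR α v p X S n ω
  set d := hopDist v n ^ α
  -- The inequality `1 + SNR < 2 ^ Rs * (1 + T)`, solved for the gain, has this threshold.
  have e1 : (2 ^ Rs - 1) * d / p n + 2 ^ Rs * d / p n * T =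
      (2 ^ Rs * (1 + T) - 1) * d / p n := by ring
  rw [e1, lt_div_iff₀ hp, ← lt_sub_iff_add_lt', div_lt_iff₀ hd, mul_comm (H n ω)]

end Hop

/-- The conditional probability of an event that, within `A`, is almost surely the complement of
`G ⊆ A`. -/
lemma cond_real_eq_one_sub {Ω : Type*} [MeasurableSpace Ω] {P : Measure Ω}
    [IsProbabilityMeasure P] {A B G : Set Ω} (hA : MeasurableSet A) (hG : MeasurableSet G)
    (hGA : G ⊆ A) (hB : ∀ᵐ ω ∂P, ω ∈ A → (ω ∈ B ↔ ω ∉ G)) {q : ℝ}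
    (hA0 : P A ≠ 0) (hq : P.real G = q * P.real A) :
    (cond P A).real B = 1 - q := by
  -- `B` itself need not be measurable: within `A` it is replaced by the measurable `A \ G`, up to a
  -- null set.
  have hAB : (A ∩ B : Set Ω) =ᵐ[P] (A \ G : Set Ω) := by
    filter_upwards [hB] with ω hω
    exact propext (and_congr_right hω)
  have hA0' : P.real A ≠ 0 := (measureReal_ne_zero_iff).2 hA0
  rw [measureReal_def, cond_apply hA, measure_congr hAB, ENNReal.toReal_mul, ENNReal.toReal_inv]
  change (P.real A)⁻¹ * P.real (A \ G) = _
  rw [measureReal_sdiff hGA hG, hq]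
  field_simp

end

/-! ### Assembling the hops. -/

theorem theorem1 {Ω : Type*} [MeasurableSpace Ω] (P : Measure Ω) [IsProbabilityMeasure P]
    (N : ℕ) (hN : 0 < N) (v : Fin (N + 1) → Plane) (hv : ∀ n : Fin N, v n.castSucc ≠ v n.succ)
    (α lam Rs : ℝ) (hα : 2 < α) (hlam : 0 < lam) (hRs : 0 ≤ Rs)
    (H : Fin N → Ω → ℝ) (X : Fin N → ℕ → Ω → Plane) (S : Fin N → ℕ → Ω → ℝ)
    (hE : IsRelayEnvironment lam H X S P) :
    ∀ p : Fin N → ℝ, (∀ n, 0 < p n) →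
      (∀ᵐ ω ∂P, ∀ n, Summable (fun e => eveSNR α v p X S n e ω)) ∧
      secrecyOutageProb P α Rs v p H X S =
        1 - Real.exp (-(K₁ α lam * (2 : ℝ) ^ (2 * Rs / α) * ∑ n, hopDist v n ^ 2)) := by
  intro p hp
  have hα0 : 0 < α := by linarith
  have : Nonempty (Fin N) := ⟨⟨0, hN⟩⟩
  have hD : ∀ n, 0 < hopDist v n := fun n => hopDist_pos (hv n)
  let s : Fin N → ℝ := fun n => 2 ^ Rs * hopDist v n ^ α
  have hs : ∀ n, 0 < s n := fun n =>
    mul_pos (Real.rpow_pos_of_pos two_pos _) (Real.rpow_pos_of_pos (hD n) _)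
  let a : Fin N → ℝ := fun n => (2 ^ Rs - 1) * hopDist v n ^ α / p n
  have ha : ∀ n, 0 ≤ a n := fun n => by
    have h1 := Real.one_le_rpow one_le_two hRs
    have h2 := Real.rpow_pos_of_pos (hD n) α
    exact div_nonneg (mul_nonneg (by linarith) h2.le) (hp n).le
  let T : Fin N → Ω → ENNReal := fun n ω =>
    interference α (s n) (v n.castSucc) (fun e => X n e ω, fun e => S n e ω)
  have hXS : ∀ n, Measurable fun ω =>
      ((fun e => X n e ω, fun e => S n e ω) : (ℕ → Plane) × (ℕ → ℝ)) := fun n =>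
    (measurable_pi_lambda _ (hE.ppp n).measurable).prodMk (measurable_pi_lambda _ (hE.measurable_S n))
  have hT : ∀ n, Measurable (T n) := fun n => (measurable_interference _ _ _).comp (hXS n)
  have hfin : ∀ᵐ ω ∂P, ∀ n, T n ω ≠ ⊤ := ae_all_iff.2 fun n =>
    ae_interference_ne_top hα (hs n) hlam.le _ (hE.ppp n) (hE.measurable_S n) (hE.law_S n)
      (hE.indep_S n) (hE.indep_X_S n)
  have hSpos : ∀ᵐ ω ∂P, ∀ n e, 0 ≤ S n e ω := ae_all_iff.2 fun n => ae_all_iff.2 fun e =>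
    ae_nonneg_of_hasLaw_expMeasure (hE.law_S n e)
  refine ⟨?_, ?_⟩
  · filter_upwards [hfin, hSpos] with ω h1 h2 n
    exact summable_eveSNR (hp n) (hs n) (h2 n) (h1 n)
  have hind : ∀ F : ∀ _ : Fin N, Set (ℝ × (ℕ → Plane) × (ℕ → ℝ)), (∀ n, MeasurableSet (F n)) →
      P {ω | ∀ n, (H n ω, fun e => X n e ω, fun e => S n e ω) ∈ F n} =
        ∏ n, P {ω | (H n ω, fun e => X n e ω, fun e => S n e ω) ∈ F n} := by
    intro F hF
    refine Eq.trans ?_ (hE.indep_hops.measure_inter_preimage_eq_mul Finset.univ (fun n _ => hF n))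
    congr 1
    ext ω
    simp
  have hPA : P {ω | ∀ n, a n < H n ω} = ∏ n, ENNReal.ofReal (Real.exp (-a n)) := by
    refine (hind (fun n => {q | a n < q.1}) fun n =>
      measurableSet_lt measurable_const measurable_fst).trans ?_
    refine Finset.prod_congr rfl fun n _ => ?_
    rw [← expMeasure_Ioi (ha n), ← (hE.law_H n).map_eq,
      Measure.map_apply (hE.measurable_H n) measurableSet_Ioi]
    rfl
  have hPG : P {ω | ∀ n, a n < H n ω ∧ ENNReal.ofReal (a n) + T n ω ≤ ENNReal.ofReal (H n ω)} =
      ∏ n, ENNReal.ofReal (Real.exp (-a n)) *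
        expNeg (ENNReal.ofReal (K₁ α lam * s n ^ (2 / α))) := by
    refine (hind (fun n => (fun q => (interference α (s n) (v n.castSucc) q.2, q.1)) ⁻¹'
      {q | a n < q.2 ∧ ENNReal.ofReal (a n) + q.1 ≤ ENNReal.ofReal q.2}) fun n =>
        (((measurable_interference _ _ _).comp measurable_snd).prodMk measurable_fst)
          (measurableSet_lt_and_add_le _)).trans ?_
    refine Finset.prod_congr rfl fun n _ => ?_
    rw [← lintegral_expNeg_interference hα (hs n) hlam.le (v n.castSucc) (hE.ppp n)
      (hE.measurable_S n) (hE.law_S n) (hE.indep_S n) (hE.indep_X_S n)]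
    exact measure_lt_and_add_le (hE.measurable_H n) (hT n) (hE.law_H n)
      ((hE.indep_H n).symm.comp (measurable_interference α (s n) (v n.castSucc)) measurable_id)
      (ha n)
  -- A minimum over a nonempty finite family is attained, so the strict bound passes between it and
  -- all hops.
  have hAeq : {ω | (2 : ℝ) ^ Rs - 1 < ⨅ n, legitSNR α v p H n ω} = {ω | ∀ n, a n < H n ω} := by
    ext ω
    change 2 ^ Rs - 1 < ⨅ n, legitSNR α v p H n ω ↔ ∀ n, a n < H n ω
    simp_rw [show ∀ n, a n < H n ω ↔ 2 ^ Rs - 1 < legitSNR α v p H n ω from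
      fun n => (lt_legitSNR_iff (hp n) (hv n) _).symm]
    obtain ⟨m, hm⟩ := exists_eq_ciInf_of_finite (f := fun n => legitSNR α v p H n ω)
    exact ⟨fun h n => h.trans_le (ciInf_le (Set.finite_range _).bddBelow n), fun h => hm ▸ h m⟩
  have hK : 0 ≤ K₁ α lam := by
    have h1 : 0 < Real.Gamma (1 - 2 / α) :=
      Real.Gamma_pos_of_pos (by rw [sub_pos, div_lt_one hα0]; exact hα)
    have h2 : 0 < Real.Gamma (1 + 2 / α) := Real.Gamma_pos_of_pos (by positivity)
    unfold K₁
    positivity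
  -- The exponent `2 / α` turns `d ^ α` into the squared hop length.
  have hspow : ∀ n, s n ^ (2 / α) = (2 : ℝ) ^ (2 * Rs / α) * hopDist v n ^ 2 := by
    intro n
    change ((2 : ℝ) ^ Rs * hopDist v n ^ α) ^ (2 / α) = _
    rw [Real.mul_rpow (by positivity) (Real.rpow_nonneg (hD n).le _), ← Real.rpow_mul two_pos.le,
      ← Real.rpow_mul (hD n).le, mul_div_cancel₀ _ hα0.ne', Real.rpow_two]
    congr 2
    ring
  unfold secrecyOutageProb
  rw [hAeq]
  -- `G` is the event that every hop transmits and is secure.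
  refine cond_real_eq_one_sub (G := {ω | ∀ n, a n < H n ω ∧
    ENNReal.ofReal (a n) + T n ω ≤ ENNReal.ofReal (H n ω)}) ?_ ?_ ?_ ?_ ?_ ?_
  · rw [Set.ofPred_forall]
    exact .iInter fun n => measurableSet_lt measurable_const (hE.measurable_H n)
  · rw [Set.ofPred_forall]
    exact .iInter fun n => ((hT n).prodMk (hE.measurable_H n)) (measurableSet_lt_and_add_le (a n))
  · exact fun ω h n => (h n).1
  · filter_upwards [hfin, hSpos] with ω h1 h2 hA
    rw [ciInf_lt_iff (Set.finite_range _).bddBelow, not_forall]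
    refine exists_congr fun n => ?_
    rw [logb_secrecy_lt_iff (hp n) (hv n) hRs (h2 n) (h1 n) (hA n), not_and]
    exact ⟨fun h _ => h, fun h => h (hA n)⟩
  · rw [hPA]
    exact Finset.prod_ne_zero_iff.2 fun n _ => (ENNReal.ofReal_pos.2 (Real.exp_pos _)).ne'
  -- The factors `exp (-a n)`, which alone contain the powers, make up `P A`; the rest is the
  -- required ratio.
  · rw [measureReal_def, measureReal_def, hPA, hPG, Finset.prod_mul_distrib, ENNReal.toReal_mul,
      mul_comm, ← expNeg_sum, ← ENNReal.ofReal_sum_of_nonneg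
        (fun n _ => mul_nonneg hK (Real.rpow_nonneg (hs n).le _)),
      expNeg_ofReal (Finset.sum_nonneg fun n _ => mul_nonneg hK (Real.rpow_nonneg (hs n).le _)),
      ENNReal.toReal_ofReal (Real.exp_pos _).le]
    simp_rw [hspow, ← mul_assoc, ← Finset.mul_sum]
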